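/- **Theorem 2.1.** Let $\mathbf x_0\in\mathbb R^3$, let $\mathbf a\in\mathbb R^3$ be a unit vector, and let $\theta_0\in(0,\pi/2)$, $r_0>0$, $\omega,\varepsilon_0,\mu_0>0$ and $\alpha\in(0,1)$. Let $$\mathcal K=\{\mathbf x\in\mathbb R^3\setminus\{\mathbf x_0\} : \text{the angle between } \mathbf x-\mathbf x_0 \text{ and } \mathbf a \text{ is less than } \theta_0\}$$ be the open convex circular cone with apex $\mathbf x_0$, axis $\mathbf a$ and opening angle $2\theta_0$, and let $\mathcal K_{r_0}=\mathcal K\cap B_{r_0}(\mathbf x_0)$, where $B_{r_0}(\mathbf x_0)=\{\mathbf x:|\mathbf x-\mathbf x_0|<r_0\}$. Let $\mathbf J_1,\mathbf J_2\in C^\alpha(\overline{\mathcal K_{r_0}})^3$ be $\mathbb C^3$-valued, and let $\mathbf E,\mathbf H\in H(\mathrm{curl},\mathcal K_{r_0})$, that is, $\mathbf E,\mathbf H\in L^2(\mathcal K_{r_0};\mathbb C^3)$ with distributional curls in $L^2(\mathcal K_{r_0};\mathbb C^3)$. Suppose that $$\begin{cases}\nabla\wedge\mathbf E-\mathrm i\omega\mu_0\mathbf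 H=\mathbf J_1 & \text{a.e. in } \mathcal K_{r_0},\\ \nabla\wedge\mathbf H+\mathrm i\omega\varepsilon_0\mathbf E=\mathbf J_2 & \text{a.e. in } \mathcal K_{r_0},\\ \nu\times\mathbf E=\nu\times\mathbf H=\mathbf 0 & \text{on } \partial\mathcal K_{r_0}\setminus\partial B_{r_0}(\mathbf x_0),\end{cases}$$ where $\nu$ is the exterior unit normal. The boundary condition is understood in the sense of tangential traces: for $\mathbf u=\mathbf E$ and $\mathbf u=\mathbf H$, $$\int_{\mathcal K_{r_0}}\big((\nabla\wedge\mathbf u)\cdot\boldsymbol\varphi-\mathbf u\cdot(\nabla\wedge\boldsymbol\varphi)\big)\,\mathrm d\mathbf x=0$$ for every $\boldsymbol\varphi\in C_c^\infty(\mathbb R^3;\mathbb C^3)$ whose support does not meet $\partial\mathcal K_{r_0}\cap\partial B_{r_0}(\mathbf x_0)$, where $\cdot$ is the bilinear product $\mathbf z\cdot\mathbf w=\sum_i z_iw_i$. Then $$\mathbf J_1(\mathbf x_0)=\mathbf J_2(\mathbf x_0)=\mathbf 0.$$ -/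

import Mathlib

open MeasureTheory Set
open scoped NNReal

/-- Euclidean space `ℝ³`. -/
abbrev R3 := EuclideanSpace ℝ (Fin 3)

/-- The space `ℂ³` of field values, with its Hermitian norm. -/
abbrev C3 := EuclideanSpace ℂ (Fin 3)

/-- The open circular cone with apex `x₀`, axis `a` and half opening angle `θ₀`: the points `x` for
which the angle between `x - x₀` and `a` is less than `θ₀`. (Mathlib's angle between `0` and `a` is
`π / 2`, so the apex is not in the cone when `θ₀ < π / 2`.) -/
def circularCone (x₀ a : R3) (θ₀ : ℝ) : Set R3 :=
  {x | InnerProductGeometry.angle (x - x₀) a < θ₀}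

/-- The cone truncated by the open ball of radius `r₀` around its apex. -/
def truncatedCone (x₀ a : R3) (θ₀ r₀ : ℝ) : Set R3 :=
  circularCone x₀ a θ₀ ∩ Metric.ball x₀ r₀

/-- The bilinear (not conjugated) product `z · w = ∑ zᵢ wᵢ` on `ℂ³`. -/
def bdot (z w : C3) : ℂ := ∑ i, z i * w i

/-- The `i`-th partial derivative of the `j`-th component of a vector field on `ℝ³`. -/
noncomputable def partialDeriv (i j : Fin 3) (φ : R3 → C3) (x : R3) : ℂ :=
  fderiv ℝ φ x (EuclideanSpace.single i 1) j

/-- The classical curl of a differentiable vector field. -/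
noncomputable def curl (φ : R3 → C3) (x : R3) : C3 :=
  !₂[partialDeriv 1 2 φ x - partialDeriv 2 1 φ x,
     partialDeriv 2 0 φ x - partialDeriv 0 2 φ x,
     partialDeriv 0 1 φ x - partialDeriv 1 0 φ x]

/-- `c` is the curl of `u` in `Ω` in the sense of distributions, both being square integrable. -/
def IsWeakCurl (Ω : Set R3) (u c : R3 → C3) : Prop :=
  MemLp u 2 (volume.restrict Ω) ∧ MemLp c 2 (volume.restrict Ω) ∧
    ∀ φ : R3 → C3, ContDiff ℝ (⊤ : ℕ∞) φ → HasCompactSupport φ → tsupport φ ⊆ Ω →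
      ∫ x in Ω, bdot (u x) (curl φ x) = ∫ x in Ω, bdot (c x) (φ x)

/-- The space `H(curl, Ω)`: square integrable fields whose distributional curl is square
integrable. -/
def MemHCurl (Ω : Set R3) (u : R3 → C3) : Prop := ∃ c, IsWeakCurl Ω u c

open Classical in
/-- The distributional curl of `u ∈ H(curl, Ω)` (unique almost everywhere in an open `Ω`, see
`IsWeakCurl.ae_eq`); the zero field for `u ∉ H(curl, Ω)`. -/
noncomputable def weakCurl (Ω : Set R3) (u : R3 → C3) : R3 → C3 :=
  if h : MemHCurl Ω u then h.choose else 0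

/-- The tangential trace `ν × u` on `∂Ω` of `u ∈ H(curl, Ω)` (`ν` the exterior unit normal), as a
functional on smooth fields `φ`, given by Green's formula
`∫_{∂Ω} (ν × u) · φ dσ = ∫_Ω (curl u · φ - u · curl φ) dx`. -/
noncomputable def tangentialTrace (Ω : Set R3) (u φ : R3 → C3) : ℂ :=
  ∫ x in Ω, (bdot (weakCurl Ω u x) (φ x) - bdot (u x) (curl φ x))

/-- `ν × u = 0` on the relatively open part `Γ` of `∂Ω`: the tangential trace of `u` vanishes on all
smooth compactly supported fields on `ℝ³` whose support does not meet `∂Ω \ Γ`. -/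
def TangentialTraceVanishesOn (Ω Γ : Set R3) (u : R3 → C3) : Prop :=
  ∀ φ : R3 → C3, ContDiff ℝ (⊤ : ℕ∞) φ → HasCompactSupport φ →
    Disjoint (tsupport φ) (frontier Ω \ Γ) → tangentialTrace Ω u φ = 0

/-- The lateral boundary `∂K \ ∂B` of the truncated cone. -/
def lateralBoundary (x₀ a : R3) (θ₀ r₀ : ℝ) : Set R3 :=
  frontier (truncatedCone x₀ a θ₀ r₀) \ Metric.sphere x₀ r₀

/-- The weak curl is unique almost everywhere. -/
theorem IsWeakCurl.ae_eq {Ω : Set R3} (hΩ : IsOpen Ω) {u c c' : R3 → C3}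
    (h : IsWeakCurl Ω u c) (h' : IsWeakCurl Ω u c') :
    ∀ᵐ x ∂(volume.restrict Ω), c x = c' x := by
  have key : ∀ j : Fin 3, ∀ᵐ x ∂volume, x ∈ Ω → c x j - c' x j = 0 := by
    intro j
    have e1 : ∀ {f : R3 → C3}, MemLp f 2 (volume.restrict Ω) →
        MemLp (fun x => f x j) 2 (volume.restrict Ω) := fun hf =>
      (EuclideanSpace.proj (𝕜 := ℂ) j).comp_memLp' hf
    have hloc : ∀ {f : R3 → C3}, MemLp f 2 (volume.restrict Ω) →
        LocallyIntegrable (fun x => f x j) (volume.restrict Ω) := fun hf =>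
      (e1 hf).locallyIntegrable (by norm_num)
    refine hΩ.ae_eq_zero_of_integral_contDiff_smul_eq_zero (f := fun x => c x j - c' x j)
      (locallyIntegrableOn_of_locallyIntegrable_restrict ((hloc h.2.1).sub (hloc h'.2.1))) ?_
    intro g hg hgc hgs
    have hφ : ContDiff ℝ (⊤ : ℕ∞) (fun x => EuclideanSpace.single j (g x : ℂ) : R3 → C3) := by
      have hs : (fun x => EuclideanSpace.single j (g x : ℂ) : R3 → C3) =
          fun x => g x • (EuclideanSpace.single j (1 : ℂ) : C3) := by
        funext x; ext i
        by_cases hij : i = j <;> simp [hij]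
      rw [hs]
      exact hg.smul contDiff_const
    have hsup : tsupport (fun x => EuclideanSpace.single j (g x : ℂ) : R3 → C3) ⊆ tsupport g := by
      refine closure_mono fun x hx hgx => hx ?_
      simp [hgx]
    have hφc : HasCompactSupport (fun x => EuclideanSpace.single j (g x : ℂ) : R3 → C3) :=
      hgc.of_isClosed_subset (isClosed_tsupport _) hsup
    have a1 := h.2.2 _ hφ hφc (hsup.trans hgs)
    have a2 := h'.2.2 _ hφ hφc (hsup.trans hgs)
    have a3 := a1.symm.trans a2
    have hb : ∀ z : C3, ∀ t : ℂ, bdot z (EuclideanSpace.single j t) = t * z j := by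
      intro z t
      simp [bdot, mul_comm]
    simp only [hb] at a3
    have hi : ∀ {f : R3 → C3}, MemLp f 2 (volume.restrict Ω) →
        Integrable (fun x => (g x : ℂ) * f x j) (volume.restrict Ω) := by
      intro f hf
      have := (hloc hf).integrable_smul_left_of_hasCompactSupport hg.continuous hgc
      simpa using this
    have a4 : ∫ x in Ω, g x • (c x j - c' x j) = 0 := by
      have : ∀ x, g x • (c x j - c' x j) = (g x : ℂ) * c x j - (g x : ℂ) * c' x j := by
        intro x; simp [mul_sub]
      simp only [this]
      rw [integral_sub (hi h.2.1) (hi h'.2.1), a3, sub_self]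
    rw [← a4, setIntegral_eq_integral_of_forall_compl_eq_zero]
    intro x hx
    have : g x = 0 := by
      by_contra hne
      exact hx (hgs (subset_tsupport _ hne))
    simp [this]
  rw [ae_restrict_iff' hΩ.measurableSet]
  filter_upwards [key 0, key 1, key 2] with x h0 h1 h2 hx
  ext i
  fin_cases i
  · exact sub_eq_zero.1 (h0 hx)
  · exact sub_eq_zero.1 (h1 hx)
  · exact sub_eq_zero.1 (h2 hx)

open Filter Topology

/-- `exp (-c ‖x‖)` is integrable for `c > 0`. -/
theorem integrable_exp_neg_mul_norm {c : ℝ} (hc : 0 < c) :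
    Integrable (fun x : R3 => Real.exp (-c * ‖x‖)) := by
  refine (integrable_fun_norm_addHaar (volume : Measure R3)
    (f := fun t : ℝ => Real.exp (-c * t))).2 ?_
  have h := integrableOn_rpow_mul_exp_neg_mul_rpow (p := 1) (s := 2) (b := c) (by norm_num)
    (by norm_num) hc
  refine h.congr_fun (fun t ht => ?_) measurableSet_Ioi
  simp

theorem integral_Ioo_inv_sub_I_mul_cos_sq_ne_zero {m : ℝ} (hm : 0 < m) :
    ∫ θ in Ioo (-Real.pi) Real.pi, 1 / ((m : ℂ) - Complex.I * Real.cos θ) ^ 2 ≠ 0 := by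
  have hpos : ∀ θ : ℝ, 0 < m ^ 2 + Real.cos θ ^ 2 := fun θ => by positivity
  have hre : ∀ θ : ℝ, (1 / ((m : ℂ) - Complex.I * Real.cos θ) ^ 2).re =
      m ^ 2 / (m ^ 2 + 1) * (1 / (m ^ 2 + Real.cos θ ^ 2)) + (-1 / (m ^ 2 + 1)) *
        ((Real.cos θ ^ 2 * (2 * m ^ 2 + 1) - m ^ 2) / (m ^ 2 + Real.cos θ ^ 2) ^ 2) := by
    intro θ
    have h1 : ((m : ℂ) - Complex.I * Real.cos θ) ^ 2 =
        ((m ^ 2 - Real.cos θ ^ 2 : ℝ) : ℂ) + ((-2 * m * Real.cos θ : ℝ) : ℂ) * Complex.I := by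
      simp only [Complex.ofReal_sub, Complex.ofReal_mul, Complex.ofReal_pow, Complex.ofReal_neg,
        Complex.ofReal_ofNat]
      linear_combination (Real.cos θ : ℂ) ^ 2 * Complex.I_sq
    have h2 : Complex.normSq (((m ^ 2 - Real.cos θ ^ 2 : ℝ) : ℂ) +
        ((-2 * m * Real.cos θ : ℝ) : ℂ) * Complex.I) = (m ^ 2 + Real.cos θ ^ 2) ^ 2 := by
      rw [Complex.normSq_add_mul_I]; ring
    rw [h1, one_div, Complex.inv_re, h2, Complex.add_re, Complex.ofReal_re,
      Complex.re_ofReal_mul, Complex.I_re]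
    have := (hpos θ).ne'
    have h3 : m ^ 2 + 1 ≠ 0 := by positivity
    field_simp
    ring
  have hcd : Continuous fun θ : ℝ => 1 / ((m : ℂ) - Complex.I * Real.cos θ) ^ 2 := by
    refine continuous_const.div (by fun_prop) fun θ h => ?_
    have h0 := pow_eq_zero_iff (two_ne_zero) |>.1 h
    have := congrArg Complex.re h0
    simp at this
    exact hm.ne' this
  have hc1 : Continuous fun θ : ℝ => 1 / (m ^ 2 + Real.cos θ ^ 2) :=
    continuous_const.div (by fun_prop) fun θ => (hpos θ).ne'
  have hc2 : Continuous fun θ : ℝ =>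
      (Real.cos θ ^ 2 * (2 * m ^ 2 + 1) - m ^ 2) / (m ^ 2 + Real.cos θ ^ 2) ^ 2 :=
    Continuous.div (by fun_prop) (by fun_prop) fun θ => pow_ne_zero _ (hpos θ).ne'
  have hpi : -Real.pi ≤ Real.pi := by linarith [Real.pi_pos]
  have hzero : ∫ θ in (-Real.pi)..Real.pi,
      (Real.cos θ ^ 2 * (2 * m ^ 2 + 1) - m ^ 2) / (m ^ 2 + Real.cos θ ^ 2) ^ 2 = 0 := by
    rw [intervalIntegral.integral_eq_sub_of_hasDerivAt
      (f := fun θ => Real.sin θ * Real.cos θ / (m ^ 2 + Real.cos θ ^ 2))]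
    · simp
    · intro θ _
      have hd := ((Real.hasDerivAt_sin θ).mul (Real.hasDerivAt_cos θ)).div
        (((Real.hasDerivAt_cos θ).pow 2).const_add (m ^ 2)) (hpos θ).ne'
      refine HasDerivAt.congr_deriv (f := fun θ => Real.sin θ * Real.cos θ /
        (m ^ 2 + Real.cos θ ^ 2)) hd ?_
      congr 1
      have := Real.sin_sq_add_cos_sq θ
      simp
      linear_combination (Real.cos θ ^ 2 - m ^ 2) * this
    · exact hc2.intervalIntegrable _ _
  have hP : 0 < ∫ θ in (-Real.pi)..Real.pi, 1 / (m ^ 2 + Real.cos θ ^ 2) :=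
    intervalIntegral.intervalIntegral_pos_of_pos (hc1.intervalIntegrable _ _)
      (fun θ => one_div_pos.2 (hpos θ)) (by linarith [Real.pi_pos])
  intro h
  rw [← integral_Ioc_eq_integral_Ioo, ← intervalIntegral.integral_of_le hpi] at h
  have h' := congrArg Complex.reCLM h
  rw [← Complex.reCLM.intervalIntegral_comp_comm (hcd.intervalIntegrable _ _)] at h'
  simp only [Complex.reCLM_apply, hre, Complex.zero_re] at h'
  rw [intervalIntegral.integral_add ((hc1.const_mul _).intervalIntegrable _ _)
    ((hc2.const_mul _).intervalIntegrable _ _), intervalIntegral.integral_const_mul,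
    intervalIntegral.integral_const_mul, hzero, mul_zero, add_zero] at h'
  have : 0 < m ^ 2 / (m ^ 2 + 1) := by positivity
  exact (mul_pos this hP).ne' h'

theorem integrableOn_mul_exp_neg_mul {m : ℝ} (hm : 0 < m) :
    IntegrableOn (fun r : ℝ => r * Real.exp (-m * r)) (Ioi 0) := by
  have h := integrableOn_rpow_mul_exp_neg_mul_rpow (p := 1) (s := 1) (b := m) (by norm_num)
    (by norm_num) hm
  exact h.congr_fun (fun t ht => by simp) measurableSet_Ioi

theorem integral_Ioi_mul_cexp_neg_mul {w : ℂ} (hw : 0 < w.re) :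
    ∫ r in Ioi (0 : ℝ), (r : ℂ) * Complex.exp (-(w * r)) = (w ^ 2)⁻¹ := by
  have hw0 : w ≠ 0 := fun h => by simp [h] at hw
  have hn : ∀ r : ℝ, ‖Complex.exp (-(w * r))‖ = Real.exp (-w.re * r) := fun r => by
    simp [Complex.norm_exp]
  have hlim : ∀ n : ℕ, Filter.Tendsto (fun r : ℝ => (r : ℂ) ^ n * Complex.exp (-(w * r)))
      Filter.atTop (nhds 0) := by
    intro n
    rw [tendsto_zero_iff_norm_tendsto_zero]
    refine (tendsto_rpow_mul_exp_neg_mul_atTop_nhds_zero n w.re hw).congr' ?_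
    filter_upwards [Filter.eventually_ge_atTop 0] with r hr
    rw [norm_mul, hn, norm_pow, Complex.norm_real, Real.norm_of_nonneg hr, Real.rpow_natCast]
  have hder : ∀ r : ℝ, HasDerivAt
      (fun r : ℝ => -w⁻¹ * ((r : ℂ) ^ 1 * Complex.exp (-(w * r))) -
        (w ^ 2)⁻¹ * ((r : ℂ) ^ 0 * Complex.exp (-(w * r))))
      ((r : ℂ) * Complex.exp (-(w * r))) r := by
    intro r
    have h1 : HasDerivAt (fun r : ℝ => (r : ℂ)) 1 r := Complex.ofRealCLM.hasDerivAt
    have h2 := ((h1.const_mul w).neg).cexp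
    have h3 := ((h1.mul h2).const_mul (-w⁻¹)).sub (h2.const_mul (w ^ 2)⁻¹)
    simp only [pow_one, pow_zero, one_mul]
    refine HasDerivAt.congr_deriv (f := fun r : ℝ => -w⁻¹ * ((r : ℂ) * Complex.exp (-(w * r))) -
        (w ^ 2)⁻¹ * Complex.exp (-(w * r))) h3 ?_
    simp only [Pi.neg_apply]
    field_simp
    ring
  rw [integral_Ioi_of_hasDerivAt_of_tendsto' (fun r _ => hder r) ?_
    (((hlim 1).const_mul _).sub ((hlim 0).const_mul _))]
  · simp
  · refine Integrable.mono' (integrableOn_mul_exp_neg_mul hw) (by fun_prop) ?_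
    refine (ae_restrict_iff' measurableSet_Ioi).2 (ae_of_all _ fun r hr => ?_)
    have hr' : (0 : ℝ) < r := hr
    rw [norm_mul, hn, Complex.norm_real, Real.norm_of_nonneg hr'.le]

/-- The plane Fourier transform of `exp (-m |y|)` at a unit frequency, in polar coordinates. -/
theorem integral_cexp_sub_mul_sqrt {m : ℝ} (hm : 0 < m) :
    ∫ q : ℝ × ℝ, Complex.exp (-(m * √(q.1 ^ 2 + q.2 ^ 2) : ℝ) + Complex.I * q.1) =
      ∫ θ in Ioo (-Real.pi) Real.pi, 1 / ((m : ℂ) - Complex.I * Real.cos θ) ^ 2 := by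
  rw [← integral_comp_polarCoord_symm]
  have hrad : ∀ θ : ℝ, ∫ r in Ioi (0 : ℝ),
      (r : ℂ) * Complex.exp (-(((m : ℂ) - Complex.I * Real.cos θ) * r)) =
        1 / ((m : ℂ) - Complex.I * Real.cos θ) ^ 2 := by
    intro θ
    simpa only [one_div] using integral_Ioi_mul_cexp_neg_mul
      (w := (m : ℂ) - Complex.I * Real.cos θ) (by simpa using hm)
  have hint : IntegrableOn (fun p : ℝ × ℝ => (p.1 : ℂ) *
      Complex.exp (-(((m : ℂ) - Complex.I * Real.cos p.2) * p.1)))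
      (Ioi 0 ×ˢ Ioo (-Real.pi) Real.pi) := by
    have h1 := integrableOn_mul_exp_neg_mul hm
    have h2 : IntegrableOn (fun _ : ℝ => (1 : ℝ)) (Ioo (-Real.pi) Real.pi) :=
      integrableOn_const (by simp)
    have h3 := Integrable.mul_prod h1 h2
    rw [Measure.prod_restrict] at h3
    refine Integrable.mono' h3 (by fun_prop) ?_
    refine (ae_restrict_iff' (measurableSet_Ioi.prod measurableSet_Ioo)).2 (ae_of_all _ ?_)
    rintro ⟨r, θ⟩ ⟨hr, _⟩
    have hr' : (0 : ℝ) < r := hr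
    simp [Complex.norm_exp, abs_of_pos hr']
  calc _ = ∫ p in Ioi (0 : ℝ) ×ˢ Ioo (-Real.pi) Real.pi, (p.1 : ℂ) *
      Complex.exp (-(((m : ℂ) - Complex.I * Real.cos p.2) * p.1)) := by
        refine setIntegral_congr_fun (measurableSet_Ioi.prod measurableSet_Ioo) ?_
        rintro ⟨r, θ⟩ ⟨hr, _⟩
        have hr' : (0 : ℝ) < r := hr
        have e : √((r * Real.cos θ) ^ 2 + (r * Real.sin θ) ^ 2) = r := by
          rw [show (r * Real.cos θ) ^ 2 + (r * Real.sin θ) ^ 2 = r ^ 2 by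
            linear_combination r ^ 2 * Real.sin_sq_add_cos_sq θ]
          exact Real.sqrt_sq hr'.le
        simp only [polarCoord_symm_apply, e, Complex.real_smul]
        congr 2
        push_cast
        ring
    _ = _ := by
        rw [Measure.volume_eq_prod] at hint ⊢
        rw [← setIntegral_prod_swap, setIntegral_prod]
        · simp only [Prod.swap_prod_mk, hrad]
        · exact hint.swap

theorem mul_sqrt_add_lt_iff {c s z w : ℝ} (hc : 0 < c) (hs : 0 < s) (hcs : c ^ 2 + s ^ 2 = 1)
    (hw : 0 ≤ w) : c * √(z ^ 2 + w) < z ↔ c / s * √w < z := by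
  have key : ∀ hz : 0 < z, (c * √(z ^ 2 + w) < z ↔ c / s * √w < z) := by
    intro hz
    rw [← pow_lt_pow_iff_left₀ (by positivity) hz.le two_ne_zero,
      ← pow_lt_pow_iff_left₀ (a := c / s * √w) (by positivity) hz.le two_ne_zero,
      mul_pow, mul_pow, Real.sq_sqrt (by positivity), Real.sq_sqrt hw, div_pow, div_mul_eq_mul_div,
      div_lt_iff₀ (by positivity)]
    constructor <;> intro h <;> nlinarith
  constructor
  · intro h
    exact (key (lt_of_le_of_lt (by positivity) h)).1 h
  · intro h
    exact (key (lt_of_le_of_lt (by positivity) h)).2 h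

/-- The Fourier–Laplace integral of a circular cone at the null vector `-b₀ + i b₁`. -/
theorem integral_cone_cexp_ne_zero (B : OrthonormalBasis (Fin 3) ℝ R3) {c s : ℝ} (hc : 0 < c)
    (hs : 0 < s) (hcs : c ^ 2 + s ^ 2 = 1) :
    ∫ y in {y : R3 | c * ‖y‖ < inner ℝ (B 0) y},
      Complex.exp (-(inner ℝ (B 0) y : ℝ) + Complex.I * (inner ℝ (B 1) y : ℝ)) ≠ 0 := by
  let e : R3 ≃ᵐ ℝ × ℝ × ℝ := (B.repr.toHomeomorph.toMeasurableEquiv.trans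
    (MeasurableEquiv.toLp 2 (Fin 3 → ℝ)).symm).trans
      ((MeasurableEquiv.piFinSuccAbove (fun _ => ℝ) 0).trans
        ((MeasurableEquiv.refl ℝ).prodCongr MeasurableEquiv.finTwoArrow))
  have he : ∀ y, e y = (inner ℝ (B 0) y, inner ℝ (B 1) y, inner ℝ (B 2) y) := by
    intro y
    simp only [← B.repr_apply_apply]
    rfl
  have hmp : MeasurePreserving e := by
    have h1 : MeasurePreserving B.repr := B.measurePreserving_repr
    have h2 := EuclideanSpace.volume_preserving_symm_measurableEquiv_toLp (Fin 3)
    have h3 := volume_preserving_piFinSuccAbove (fun _ : Fin 3 => ℝ) 0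
    have h4 : MeasurePreserving (Prod.map (id : ℝ → ℝ) (MeasurableEquiv.finTwoArrow (α := ℝ))) :=
      (MeasurePreserving.id volume).prod (volume_preserving_finTwoArrow ℝ)
    exact h4.comp (h3.comp (h2.comp h1))
  have hnorm : ∀ y : R3, ‖y‖ =
      √(inner ℝ (B 0) y ^ 2 + (inner ℝ (B 1) y ^ 2 + inner ℝ (B 2) y ^ 2)) := by
    intro y
    rw [← B.repr.norm_map y, EuclideanSpace.norm_eq]
    simp [Fin.sum_univ_three, B.repr_apply_apply, add_assoc]
  set m := c / s with hm
  have hm0 : 0 < m := div_pos hc hs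
  let S : Set (ℝ × ℝ × ℝ) := {p | m * √(p.2.1 ^ 2 + p.2.2 ^ 2) < p.1}
  have hSm : MeasurableSet S := measurableSet_lt (by fun_prop) (by fun_prop)
  let g : ℝ × ℝ × ℝ → ℂ := fun p => Complex.exp (-(p.1 : ℝ) + Complex.I * (p.2.1 : ℝ))
  have hpre : {y : R3 | c * ‖y‖ < inner ℝ (B 0) y} = e ⁻¹' S := by
    ext y
    simp only [mem_ofPred_eq, mem_preimage, S, he]
    rw [hnorm]
    exact mul_sqrt_add_lt_iff hc hs hcs (by positivity)
  have hI : ∫ y in {y : R3 | c * ‖y‖ < inner ℝ (B 0) y},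
      Complex.exp (-(inner ℝ (B 0) y : ℝ) + Complex.I * (inner ℝ (B 1) y : ℝ)) =
        ∫ p in S, g p := by
    rw [hpre, ← hmp.setIntegral_preimage_emb e.measurableEmbedding]
    simp only [g, he]
  have hint : IntegrableOn g S := by
    rw [← hmp.integrableOn_comp_preimage e.measurableEmbedding, ← hpre]
    refine Integrable.mono' (integrable_exp_neg_mul_norm hc).integrableOn
      (Measurable.aestronglyMeasurable (by fun_prop)) ?_
    refine (ae_restrict_iff' (by rw [hpre]; exact e.measurable hSm)).2 (ae_of_all _ ?_)
    intro y hy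
    simp only [Function.comp, g, he, Complex.norm_exp]
    simp only [mem_ofPred_eq] at hy
    simp
    linarith
  have hz : ∀ q : ℝ × ℝ, ∫ z : ℝ, S.indicator g (z, q) =
      Complex.exp (-(m * √(q.1 ^ 2 + q.2 ^ 2) : ℝ) + Complex.I * q.1) := by
    intro q
    have e1 : (fun z : ℝ => S.indicator g (z, q)) =
        (Ioi (m * √(q.1 ^ 2 + q.2 ^ 2))).indicator
          (fun z => ((Real.exp (-z) : ℝ) : ℂ) * Complex.exp (Complex.I * q.1)) := by
      funext z
      by_cases hz : m * √(q.1 ^ 2 + q.2 ^ 2) < z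
      · rw [indicator_of_mem (show (z, q) ∈ S from hz), indicator_of_mem (show z ∈ Ioi _ from hz)]
        simp [g, Complex.exp_add]
      · rw [indicator_of_notMem (show (z, q) ∉ S from hz),
          indicator_of_notMem (show z ∉ Ioi _ from hz)]
    rw [e1, integral_indicator measurableSet_Ioi, integral_mul_const,
      integral_complex_ofReal, integral_exp_neg_Ioi, Complex.exp_add]
    push_cast
    rfl
  rw [hI, ← integral_indicator hSm, Measure.volume_eq_prod, integral_prod_symm]
  · simp only [hz]
    rw [integral_cexp_sub_mul_sqrt hm0]
    exact integral_Ioo_inv_sub_I_mul_cos_sq_ne_zero hm0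
  · rw [← Measure.volume_eq_prod, integrable_indicator_iff hSm]
    exact hint

/-- The bilinear cross product on `ℂ³`. -/
def ccross (z w : C3) : C3 :=
  !₂[z 1 * w 2 - z 2 * w 1, z 2 * w 0 - z 0 * w 2, z 0 * w 1 - z 1 * w 0]

/-- The gradient of a complex function on `ℝ³`. -/
noncomputable def cgrad (g : R3 → ℂ) (x : R3) : C3 :=
  WithLp.toLp 2 fun i => fderiv ℝ g x (EuclideanSpace.single i 1)

theorem curl_smul_const {g : R3 → ℂ} {x : R3} (hg : DifferentiableAt ℝ g x) (p : C3) :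
    curl (fun y => g y • p) x = ccross (cgrad g x) p := by
  ext i
  fin_cases i <;> simp [curl, partialDeriv, ccross, cgrad, fderiv_smul_const hg]

/-- The phase `s (-a + i τ b) · x` of a complex plane wave. -/
noncomputable def wavePhase (a b : R3) (s τ : ℝ) : R3 →L[ℝ] ℂ :=
  (-(s : ℂ)) • (Complex.ofRealCLM ∘L innerSL ℝ a) +
    (Complex.I * s * τ) • (Complex.ofRealCLM ∘L innerSL ℝ b)

theorem wavePhase_apply (a b : R3) (s τ : ℝ) (x : R3) :
    wavePhase a b s τ x = -(s : ℂ) * (inner ℝ a x : ℝ) + Complex.I * s * τ * (inner ℝ b x : ℝ) := by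
  simp [wavePhase]

theorem wavePhase_smul (a b : R3) {s : ℝ} (hs : s ≠ 0) (τ : ℝ) (x : R3) :
    wavePhase a b s τ (s⁻¹ • x) = wavePhase a b 1 τ x := by
  have : (s : ℂ) ≠ 0 := by exact_mod_cast hs
  simp only [wavePhase_apply, inner_smul_right]
  push_cast
  field_simp

theorem norm_cexp_wavePhase (a b : R3) (s τ : ℝ) (x : R3) :
    ‖Complex.exp (wavePhase a b s τ x)‖ = Real.exp (-(s * inner ℝ a x)) := by
  simp [Complex.norm_exp, wavePhase_apply]

/-- The amplitude `b + i τ a + l (a × b)`. -/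
noncomputable def waveAmp (a b : R3) (τ l : ℝ) : C3 :=
  !₂[b 0 + Complex.I * τ * a 0 + l * (a 1 * b 2 - a 2 * b 1),
     b 1 + Complex.I * τ * a 1 + l * (a 2 * b 0 - a 0 * b 2),
     b 2 + Complex.I * τ * a 2 + l * (a 0 * b 1 - a 1 * b 0)]

theorem continuous_waveAmp (a b : R3) : Continuous fun v : ℝ × ℝ => waveAmp a b v.1 v.2 := by
  unfold waveAmp
  fun_prop

theorem ccross_wavePhase_waveAmp {a b : R3} (ha : ‖a‖ = 1) (hb : ‖b‖ = 1)
    (hab : inner ℝ a b = 0) {s τ l : ℝ} (hτ : τ ^ 2 = 1 + l ^ 2) :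
    ccross (WithLp.toLp 2 fun i => wavePhase a b s τ (EuclideanSpace.single i 1))
      (waveAmp a b τ l) = ((s * l : ℝ) : ℂ) • waveAmp a b τ l := by
  have e1 : ((a 0 : ℝ) : ℂ) ^ 2 + (a 1 : ℂ) ^ 2 + (a 2 : ℂ) ^ 2 = 1 := by
    have h : inner ℝ a a = 1 := by rw [real_inner_self_eq_norm_sq, ha]; norm_num
    simp only [PiLp.inner_apply, Fin.sum_univ_three, RCLike.inner_apply, conj_trivial] at h
    have h' := congrArg (fun r : ℝ => (r : ℂ)) h
    push_cast at h'
    linear_combination h'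
  have e2 : ((b 0 : ℝ) : ℂ) ^ 2 + (b 1 : ℂ) ^ 2 + (b 2 : ℂ) ^ 2 = 1 := by
    have h : inner ℝ b b = 1 := by rw [real_inner_self_eq_norm_sq, hb]; norm_num
    simp only [PiLp.inner_apply, Fin.sum_univ_three, RCLike.inner_apply, conj_trivial] at h
    have h' := congrArg (fun r : ℝ => (r : ℂ)) h
    push_cast at h'
    linear_combination h'
  have e3 : ((a 0 : ℝ) : ℂ) * b 0 + (a 1 : ℂ) * b 1 + (a 2 : ℂ) * b 2 = 0 := by
    have h := hab
    simp only [PiLp.inner_apply, Fin.sum_univ_three, RCLike.inner_apply, conj_trivial] at h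
    have h' := congrArg (fun r : ℝ => (r : ℂ)) h
    push_cast at h'
    linear_combination h'
  have e4 : (τ : ℂ) ^ 2 = 1 + (l : ℂ) ^ 2 := by exact_mod_cast hτ
  have e5 := Complex.I_sq
  ext i
  fin_cases i <;>
  simp [ccross, waveAmp, wavePhase_apply, EuclideanSpace.inner_single_right]
  · linear_combination s * (l * b 0 * e1 + Complex.I * τ * l * a 0 * e2 -
      (l * a 0 + Complex.I * τ * l * b 0) * e3 - τ ^ 2 * (a 1 * b 2 - a 2 * b 1) * e5 +
      (a 1 * b 2 - a 2 * b 1) * e4)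
  · linear_combination s * (l * b 1 * e1 + Complex.I * τ * l * a 1 * e2 -
      (l * a 1 + Complex.I * τ * l * b 1) * e3 - τ ^ 2 * (a 2 * b 0 - a 0 * b 2) * e5 +
      (a 2 * b 0 - a 0 * b 2) * e4)
  · linear_combination s * (l * b 2 * e1 + Complex.I * τ * l * a 2 * e2 -
      (l * a 2 + Complex.I * τ * l * b 2) * e3 - τ ^ 2 * (a 0 * b 1 - a 1 * b 0) * e5 +
      (a 0 * b 1 - a 1 * b 0) * e4)

theorem mem_truncatedCone_iff {x₀ a : R3} (ha : ‖a‖ = 1) {θ₀ r₀ : ℝ}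
    (hθ₀ : θ₀ ∈ Ioo 0 (Real.pi / 2)) (x : R3) :
    x ∈ truncatedCone x₀ a θ₀ r₀ ↔
      Real.cos θ₀ * ‖x - x₀‖ < inner ℝ a (x - x₀) ∧ ‖x - x₀‖ < r₀ := by
  rw [truncatedCone, mem_inter_iff, Metric.mem_ball, dist_eq_norm]
  refine and_congr_left fun _ => ?_
  rw [circularCone, mem_ofPred_eq]
  rcases eq_or_ne (x - x₀) 0 with h | h
  · simp [h, hθ₀.2.le]
  · have hn : 0 < ‖x - x₀‖ := norm_pos_iff.2 h
    have h1 := InnerProductGeometry.cos_angle_mul_norm_mul_norm (x - x₀) a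
    rw [ha, mul_one] at h1
    rw [real_inner_comm, ← h1, mul_lt_mul_iff_left₀ hn]
    exact (Real.strictAntiOn_cos.lt_iff_gt ⟨hθ₀.1.le, by linarith [hθ₀.2, Real.pi_pos]⟩
      ⟨InnerProductGeometry.angle_nonneg _ _, InnerProductGeometry.angle_le_pi _ _⟩).symm

theorem isOpen_truncatedCone {x₀ a : R3} (ha : ‖a‖ = 1) {θ₀ r₀ : ℝ}
    (hθ₀ : θ₀ ∈ Ioo 0 (Real.pi / 2)) : IsOpen (truncatedCone x₀ a θ₀ r₀) := by
  have : truncatedCone x₀ a θ₀ r₀ = {x | Real.cos θ₀ * ‖x - x₀‖ < inner ℝ a (x - x₀)} ∩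
      {x | ‖x - x₀‖ < r₀} := by
    ext x
    exact mem_truncatedCone_iff ha hθ₀ x
  rw [this]
  exact (isOpen_lt (by fun_prop) (by fun_prop)).inter (isOpen_lt (by fun_prop) (by fun_prop))

theorem apex_mem_closure_truncatedCone {x₀ a : R3} (ha : ‖a‖ = 1) {θ₀ r₀ : ℝ}
    (hθ₀ : θ₀ ∈ Ioo 0 (Real.pi / 2)) (hr₀ : 0 < r₀) :
    x₀ ∈ closure (truncatedCone x₀ a θ₀ r₀) := by
  have hlim : Tendsto (fun t : ℝ => x₀ + t • a) (𝓝[>] 0) (𝓝 x₀) := by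
    have : Tendsto (fun t : ℝ => x₀ + t • a) (𝓝 0) (𝓝 (x₀ + (0 : ℝ) • a)) :=
      Continuous.tendsto (by fun_prop) 0
    rw [zero_smul, add_zero] at this
    exact this.mono_left nhdsWithin_le_nhds
  refine mem_closure_of_tendsto hlim ?_
  filter_upwards [Ioo_mem_nhdsGT hr₀] with t ht
  have hc : Real.cos θ₀ < 1 := by
    rw [← Real.cos_zero]
    exact Real.cos_lt_cos_of_nonneg_of_le_pi_div_two le_rfl hθ₀.2.le hθ₀.1
  rw [mem_truncatedCone_iff ha hθ₀, add_sub_cancel_left, norm_smul, inner_smul_right,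
    real_inner_self_eq_norm_sq, ha, Real.norm_of_nonneg ht.1.le]
  constructor
  · nlinarith [ht.1]
  · simpa using ht.2

/-- Contributions away from the apex are exponentially small. -/
theorem tendsto_pow_mul_setIntegral_cexp_of_eq_zero {x₀ a b : R3} (ha : ‖a‖ = 1) {θ₀ r₀ : ℝ}
    (hθ₀ : θ₀ ∈ Ioo 0 (Real.pi / 2)) (τ : ℝ → ℝ) {f : R3 → ℂ}
    (hf : IntegrableOn f (truncatedCone x₀ a θ₀ r₀)) {ρ : ℝ} (hρ : 0 < ρ)
    (hf0 : ∀ x ∈ Metric.ball x₀ ρ, f x = 0) :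
    Tendsto (fun s : ℝ => (s : ℂ) ^ 3 * ∫ x in truncatedCone x₀ a θ₀ r₀,
      f x * Complex.exp (wavePhase a b s (τ s) (x - x₀))) atTop (𝓝 0) := by
  set Ω := truncatedCone x₀ a θ₀ r₀
  have hc : 0 < Real.cos θ₀ := Real.cos_pos_of_mem_Ioo ⟨by linarith [hθ₀.1, Real.pi_pos], hθ₀.2⟩
  have hlim := (tendsto_rpow_mul_exp_neg_mul_atTop_nhds_zero 3 (Real.cos θ₀ * ρ)
    (by positivity)).mul_const (∫ x in Ω, ‖f x‖)
  rw [zero_mul] at hlim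
  refine squeeze_zero_norm' ?_ hlim
  filter_upwards [eventually_ge_atTop 0] with s hs
  have hb : ‖∫ x in Ω, f x * Complex.exp (wavePhase a b s (τ s) (x - x₀))‖ ≤
      ∫ x in Ω, Real.exp (-(Real.cos θ₀ * ρ) * s) * ‖f x‖ := by
    refine norm_integral_le_of_norm_le (hf.norm.const_mul _) ?_
    refine (ae_restrict_iff' (isOpen_truncatedCone ha hθ₀).measurableSet).2
      (ae_of_all _ fun x hx => ?_)
    rw [norm_mul, norm_cexp_wavePhase, mul_comm]
    by_cases hxb : x ∈ Metric.ball x₀ ρ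
    · simp [hf0 x hxb]
    · gcongr
      have h1 := ((mem_truncatedCone_iff ha hθ₀ x).1 hx).1
      rw [Metric.mem_ball, dist_eq_norm, not_lt] at hxb
      have h2 : Real.cos θ₀ * ρ ≤ inner ℝ a (x - x₀) := by nlinarith
      nlinarith
  rw [integral_const_mul] at hb
  rw [norm_mul, norm_pow, Complex.norm_real, Real.norm_of_nonneg hs, mul_assoc]
  gcongr
  exact_mod_cast le_rfl

/-- Blow-up of an oscillating Laplace integral at the apex. -/
theorem tendsto_pow_mul_setIntegral_cexp {x₀ a b : R3} (ha : ‖a‖ = 1) {θ₀ r₀ : ℝ}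
    (hθ₀ : θ₀ ∈ Ioo 0 (Real.pi / 2)) (hr₀ : 0 < r₀) {τ : ℝ → ℝ} (hτ : Tendsto τ atTop (𝓝 1))
    {f : R3 → ℂ} (hf : ContinuousOn f (closure (truncatedCone x₀ a θ₀ r₀))) :
    Tendsto (fun s : ℝ => (s : ℂ) ^ 3 * ∫ x in truncatedCone x₀ a θ₀ r₀,
      f x * Complex.exp (wavePhase a b s (τ s) (x - x₀))) atTop
      (𝓝 (f x₀ * ∫ y in {y : R3 | Real.cos θ₀ * ‖y‖ < inner ℝ a y},
        Complex.exp (wavePhase a b 1 1 y))) := by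
  classical
  set Ω := truncatedCone x₀ a θ₀ r₀ with hΩ
  set K : Set R3 := {y | Real.cos θ₀ * ‖y‖ < inner ℝ a y} with hK
  have hc : 0 < Real.cos θ₀ := Real.cos_pos_of_mem_Ioo ⟨by linarith [hθ₀.1, Real.pi_pos], hθ₀.2⟩
  have hΩm : MeasurableSet Ω := (isOpen_truncatedCone ha hθ₀).measurableSet
  have hKm : MeasurableSet K := measurableSet_lt (by fun_prop) (by fun_prop)
  have hmem : ∀ s : ℝ, 0 < s → ∀ y : R3, x₀ + s⁻¹ • y ∈ Ω ↔ y ∈ K ∧ s⁻¹ * ‖y‖ < r₀ := by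
    intro s hs y
    rw [hΩ, mem_truncatedCone_iff ha hθ₀, add_sub_cancel_left, norm_smul, inner_smul_right,
      Real.norm_of_nonneg (inv_pos.2 hs).le, mul_left_comm, mul_lt_mul_iff_right₀ (inv_pos.2 hs)]
    rfl
  obtain ⟨M, hM⟩ : ∃ M, ∀ x ∈ closure Ω, ‖f x‖ ≤ M := by
    have hbd : Bornology.IsBounded Ω := Metric.isBounded_ball.subset inter_subset_right
    exact (hbd.isCompact_closure).exists_bound_of_continuousOn hf
  have hM0 : 0 ≤ M := (norm_nonneg _).trans (hM x₀ (apex_mem_closure_truncatedCone ha hθ₀ hr₀))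
  let g : ℝ → R3 → ℂ := fun s => Ω.indicator
    fun x => f x * Complex.exp (wavePhase a b s (τ s) (x - x₀))
  have hgm : ∀ s, Measurable (g s) := by
    intro s
    have h : ContinuousOn (fun x => f x * Complex.exp (wavePhase a b s (τ s) (x - x₀))) Ω :=
      (hf.mono subset_closure).mul (by fun_prop)
    have := h.measurable_piecewise (g := 0) continuousOn_const hΩm
    rwa [piecewise_eq_indicator] at this
  have hscale : ∀ s : ℝ, 0 < s → (s : ℂ) ^ 3 * ∫ x in Ω,
      f x * Complex.exp (wavePhase a b s (τ s) (x - x₀)) = ∫ y, g s (x₀ + s⁻¹ • y) := by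
    intro s hs
    rw [← integral_indicator hΩm, Measure.integral_comp_inv_smul volume (fun y => g s (x₀ + y)) s,
      integral_add_left_eq_self (g s)]
    simp [abs_of_pos hs, g]
  have hgK : ∀ s : ℝ, 0 < s → ∀ y, x₀ + s⁻¹ • y ∈ Ω →
      g s (x₀ + s⁻¹ • y) = f (x₀ + s⁻¹ • y) * Complex.exp (wavePhase a b 1 (τ s) y) := by
    intro s hs y hy
    simp only [g]
    rw [indicator_of_mem hy, add_sub_cancel_left, wavePhase_smul _ _ hs.ne']
  rw [← integral_const_mul, ← integral_indicator hKm]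
  refine Tendsto.congr' (f₁ := fun s : ℝ => ∫ y, g s (x₀ + s⁻¹ • y)) ?_ ?_
  · filter_upwards [eventually_gt_atTop 0] with s hs using (hscale s hs).symm
  refine tendsto_integral_filter_of_dominated_convergence
    (fun y => M * Real.exp (-Real.cos θ₀ * ‖y‖)) ?_ ?_
    ((integrable_exp_neg_mul_norm hc).const_mul M) ?_
  · exact Eventually.of_forall fun s =>
      ((hgm s).comp (by fun_prop : Measurable fun y : R3 => x₀ + s⁻¹ • y)).aestronglyMeasurable
  · filter_upwards [eventually_gt_atTop 0] with s hs
    refine ae_of_all _ fun y => ?_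
    by_cases hy : x₀ + s⁻¹ • y ∈ Ω
    · rw [hgK s hs y hy, norm_mul, norm_cexp_wavePhase, one_mul]
      have h1 : Real.cos θ₀ * ‖y‖ < inner ℝ a y := ((hmem s hs y).1 hy).1
      gcongr
      · exact hM _ (subset_closure hy)
      · linarith
    · simp only [g]
      rw [indicator_of_notMem hy, norm_zero]
      positivity
  · refine ae_of_all _ fun y => ?_
    by_cases hy : y ∈ K
    · rw [indicator_of_mem hy]
      have hinv : Tendsto (fun s : ℝ => s⁻¹ * ‖y‖) atTop (𝓝 0) := by
        simpa using tendsto_inv_atTop_zero.mul_const ‖y‖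
      have hev : ∀ᶠ s : ℝ in atTop, x₀ + s⁻¹ • y ∈ Ω := by
        filter_upwards [eventually_gt_atTop 0, hinv.eventually_lt_const hr₀] with s hs h
        exact (hmem s hs y).2 ⟨hy, h⟩
      have hpt : Tendsto (fun s : ℝ => x₀ + s⁻¹ • y) atTop (𝓝[closure Ω] x₀) := by
        refine tendsto_nhdsWithin_iff.2 ⟨?_, hev.mono fun s h => subset_closure h⟩
        simpa using ((tendsto_inv_atTop_zero (𝕜 := ℝ)).smul_const y).const_add x₀
      have hfl := (hf x₀ (apex_mem_closure_truncatedCone ha hθ₀ hr₀)).tendsto.comp hpt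
      have hph : Continuous fun t : ℝ => Complex.exp (wavePhase a b 1 t y) := by
        simp only [wavePhase_apply]
        fun_prop
      refine (hfl.mul ((hph.tendsto 1).comp hτ)).congr' ?_
      filter_upwards [eventually_gt_atTop 0, hev] with s hs h
      exact (hgK s hs y h).symm
    · rw [indicator_of_notMem hy]
      refine tendsto_const_nhds.congr' ?_
      filter_upwards [eventually_gt_atTop 0] with s hs
      simp only [g]
      rw [indicator_of_notMem fun h => hy ((hmem s hs y).1 h).1]

theorem integrableOn_mul_continuous {Ω : Set R3} (hΩ : MeasurableSet Ω)
    (hb : Bornology.IsBounded Ω) {f g : R3 → ℂ} (hf : IntegrableOn f Ω) (hg : Continuous g) :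
    IntegrableOn (fun x => f x * g x) Ω :=
  hf.mul_continuousOn_of_subset hg.continuousOn hΩ hb.isCompact_closure subset_closure

theorem integrableOn_coord {Ω : Set R3} {u : R3 → C3} (hu : IntegrableOn u Ω) (i : Fin 3) :
    IntegrableOn (fun x => u x i) Ω :=
  (EuclideanSpace.proj (𝕜 := ℂ) i).integrable_comp hu

theorem integrableOn_bdot {Ω : Set R3} (hΩ : MeasurableSet Ω) (hb : Bornology.IsBounded Ω)
    {u φ : R3 → C3} (hu : IntegrableOn u Ω) (hφ : Continuous φ) :
    IntegrableOn (fun x => bdot (u x) (φ x)) Ω := by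
  unfold bdot
  exact integrable_finsetSum _ fun i _ =>
    integrableOn_mul_continuous hΩ hb (integrableOn_coord hu i) (by fun_prop)

theorem continuous_curl {φ : R3 → C3} (hφ : ContDiff ℝ (⊤ : ℕ∞) φ) : Continuous (curl φ) := by
  have h : Continuous (fderiv ℝ φ) := hφ.continuous_fderiv (by simp)
  unfold curl partialDeriv
  fun_prop

theorem continuous_cgrad {g : R3 → ℂ} (hg : ContDiff ℝ (⊤ : ℕ∞) g) : Continuous (cgrad g) := by
  have h : Continuous (fderiv ℝ g) := hg.continuous_fderiv (by simp)
  unfold cgrad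
  fun_prop

theorem cgrad_mul_cexp_wavePhase (a b x₀ : R3) (s τ : ℝ) {X : R3 → ℂ} {x : R3}
    (hX : DifferentiableAt ℝ X x) :
    cgrad (fun y => X y * Complex.exp (wavePhase a b s τ (y - x₀))) x =
      Complex.exp (wavePhase a b s τ (x - x₀)) • (cgrad X x +
        X x • WithLp.toLp 2 fun i => wavePhase a b s τ (EuclideanSpace.single i 1)) := by
  have h1 : HasFDerivAt (fun y : R3 => wavePhase a b s τ (y - x₀)) (wavePhase a b s τ) x := by
    simpa only [map_sub] using (wavePhase a b s τ).hasFDerivAt.sub_const (wavePhase a b s τ x₀)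
  ext i
  simp only [cgrad]
  rw [fderiv_fun_mul hX h1.cexp.differentiableAt, h1.cexp.fderiv]
  simp
  ring

theorem integral_cexp_wavePhase_ne_zero {a b : R3} (ha : ‖a‖ = 1) (hb : ‖b‖ = 1)
    (hab : inner ℝ a b = 0) {θ₀ : ℝ} (hθ₀ : θ₀ ∈ Ioo 0 (Real.pi / 2)) :
    ∫ y in {y : R3 | Real.cos θ₀ * ‖y‖ < inner ℝ a y}, Complex.exp (wavePhase a b 1 1 y) ≠ 0 := by
  have hon : Orthonormal ℝ (({0, 1} : Set (Fin 3)).domRestrict ![a, b, 0]) := by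
    rw [orthonormal_iff_ite]
    rintro ⟨i, hi⟩ ⟨j, hj⟩
    rcases hi with rfl | hi <;> rcases hj with rfl | hj
    · simp [ha]
    · obtain rfl : j = 1 := hj
      simp [hab, Subtype.ext_iff]
    · obtain rfl : i = 1 := hi
      simp [real_inner_comm, hab, Subtype.ext_iff]
    · obtain rfl : j = 1 := hj
      obtain rfl : i = 1 := hi
      simp [hb]
  obtain ⟨B, hB⟩ := hon.exists_orthonormalBasis_extension_of_card_eq (by simp)
  have hB0 : B 0 = a := hB 0 (by simp)
  have hB1 : B 1 = b := hB 1 (by simp)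
  have hc : 0 < Real.cos θ₀ :=
    Real.cos_pos_of_mem_Ioo ⟨by linarith [hθ₀.1, Real.pi_pos], hθ₀.2⟩
  have hs : 0 < Real.sin θ₀ :=
    Real.sin_pos_of_pos_of_lt_pi hθ₀.1 (by linarith [hθ₀.2, Real.pi_pos])
  have h := integral_cone_cexp_ne_zero B hc hs (Real.cos_sq_add_sin_sq θ₀)
  rw [hB0, hB1] at h
  simpa only [wavePhase_apply, Complex.ofReal_one, mul_one, neg_mul, one_mul] using h

theorem integrableOn_ccross_cgrad {Ω : Set R3} (hΩm : MeasurableSet Ω)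
    (hΩb : Bornology.IsBounded Ω) {F : R3 → C3} (hF : IntegrableOn F Ω) {X : R3 → ℂ}
    (hX : ContDiff ℝ (⊤ : ℕ∞) X) (j : Fin 3) :
    IntegrableOn (fun x => ccross (F x) (cgrad X x) j) Ω := by
  have hXc : ∀ i, Continuous fun x => cgrad X x i := fun i => by
    exact (EuclideanSpace.proj (𝕜 := ℂ) i).continuous.comp (continuous_cgrad hX)
  have h : ∀ i k, IntegrableOn (fun x => F x i * cgrad X x k) Ω := fun i k =>
    integrableOn_mul_continuous hΩm hΩb (integrableOn_coord hF i) (hXc k)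
  fin_cases j
  · exact (h 1 2).sub (h 2 1)
  · exact (h 2 0).sub (h 0 2)
  · exact (h 0 1).sub (h 1 0)

/-- Green's formula for a cut-off Beltrami plane wave. -/
theorem sum_waveAmp_mul_integral_eq {Ω S : Set R3} {x₀ a b : R3} (ha : ‖a‖ = 1) (hb : ‖b‖ = 1)
    (hab : inner ℝ a b = 0) (hΩm : MeasurableSet Ω) (hΩb : Bornology.IsBounded Ω) {κ : ℝ}
    {F C G : R3 → C3} (hF : IntegrableOn F Ω) (hG : ContinuousOn G (closure Ω))
    (hC : ∀ᵐ x ∂(volume.restrict Ω), C x = (κ : ℂ) • F x + G x)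
    (htr : ∀ φ : R3 → C3, ContDiff ℝ (⊤ : ℕ∞) φ → HasCompactSupport φ →
      Disjoint (tsupport φ) S → ∫ x in Ω, (bdot (C x) (φ x) - bdot (F x) (curl φ x)) = 0)
    {X : R3 → ℂ} (hX : ContDiff ℝ (⊤ : ℕ∞) X)
    (hXs : HasCompactSupport X ∧ Disjoint (tsupport X) S)
    {s τ l : ℝ} (hτl : τ ^ 2 = 1 + l ^ 2) (hsl : s * l = κ) :
    ∑ j, waveAmp a b τ l j * ∫ x in Ω, X x * G x j *
        Complex.exp (wavePhase a b s τ (x - x₀)) =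
      ∑ j, waveAmp a b τ l j * ∫ x in Ω, ccross (F x) (cgrad X x) j *
        Complex.exp (wavePhase a b s τ (x - x₀)) := by
  let e : R3 → ℂ := fun x => Complex.exp (wavePhase a b s τ (x - x₀))
  have hec : Continuous e := by simp only [e]; fun_prop
  have hGj : ∀ j, ContinuousOn (fun x => X x * G x j) (closure Ω) := fun j =>
    hX.continuous.continuousOn.mul
      ((EuclideanSpace.proj (𝕜 := ℂ) j).continuous.comp_continuousOn hG)
  have hAi : ∀ j, IntegrableOn (fun x => X x * G x j * e x) Ω := fun j =>
    integrableOn_mul_continuous hΩm hΩb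
      (((hGj j).integrableOn_compact hΩb.isCompact_closure).mono_set subset_closure) hec
  have hBi : ∀ j, IntegrableOn (fun x => ccross (F x) (cgrad X x) j * e x) Ω := fun j =>
    integrableOn_mul_continuous hΩm hΩb (integrableOn_ccross_cgrad hΩm hΩb hF hX j) hec
  let g : R3 → ℂ := fun x => X x * e x
  have hg : ContDiff ℝ (⊤ : ℕ∞) g := by
    refine hX.mul (ContDiff.cexp ?_)
    exact (wavePhase a b s τ).contDiff.comp (contDiff_id.sub contDiff_const)
  have hsupp : tsupport (fun x => g x • waveAmp a b τ l) ⊆ tsupport X := by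
    refine closure_mono fun x hx h => hx ?_
    simp [g, h]
  have h0 := htr (fun x => g x • waveAmp a b τ l) (hg.smul contDiff_const)
    (hXs.1.of_isClosed_subset (isClosed_tsupport _) hsupp) (hXs.2.mono_left hsupp)
  have h1 : ∫ x in Ω, (∑ j, waveAmp a b τ l j * (X x * G x j * e x) -
      ∑ j, waveAmp a b τ l j * (ccross (F x) (cgrad X x) j * e x)) = 0 := by
    rw [← h0]
    refine integral_congr_ae ?_
    filter_upwards [hC] with x hx
    have hcurl : curl (fun x => g x • waveAmp a b τ l) x =
        e x • (ccross (cgrad X x) (waveAmp a b τ l) + (X x * κ) • waveAmp a b τ l) := by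
      have hXd : DifferentiableAt ℝ X x := (hX.differentiable (by simp)).differentiableAt
      rw [curl_smul_const (hg.differentiable (by simp)).differentiableAt,
        cgrad_mul_cexp_wavePhase _ _ _ _ _ hXd]
      have hw := ccross_wavePhase_waveAmp ha hb hab (s := s) hτl
      rw [hsl] at hw
      rw [mul_smul, ← hw]
      ext i
      fin_cases i <;> simp [ccross, e] <;> ring
    rw [hcurl, hx]
    simp [bdot, ccross, Fin.sum_univ_three, g]
    ring
  rw [integral_sub (integrable_finsetSum _ fun j _ => (hAi j).const_mul _)
    (integrable_finsetSum _ fun j _ => (hBi j).const_mul _),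
    integral_finsetSum _ fun j _ => (hAi j).const_mul _,
    integral_finsetSum _ fun j _ => (hBi j).const_mul _, sub_eq_zero] at h1
  simpa only [integral_const_mul] using h1

theorem tendsto_waveAmp (a b : R3) {τ l : ℝ → ℝ} {τ₀ l₀ : ℝ} (hτ : Tendsto τ atTop (𝓝 τ₀))
    (hl : Tendsto l atTop (𝓝 l₀)) :
    Tendsto (fun s => waveAmp a b (τ s) (l s)) atTop (𝓝 (waveAmp a b τ₀ l₀)) := by
  have h1 : Tendsto (fun s => (τ s, l s)) atTop (𝓝 (τ₀, l₀)) := hτ.prodMk_nhds hl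
  have h2 := ((continuous_waveAmp a b).tendsto (τ₀, l₀)).comp h1
  exact h2

theorem exists_cutoff (x₀ : R3) {r : ℝ} (hr : 0 < r) :
    ∃ X : R3 → ℂ, ContDiff ℝ (⊤ : ℕ∞) X ∧ HasCompactSupport X ∧
      Disjoint (tsupport X) (Metric.sphere x₀ r) ∧ X x₀ = 1 ∧
      ∀ x ∈ Metric.ball x₀ (r / 3), cgrad X x = 0 := by
  obtain ⟨χ, hin, hout⟩ : ∃ χ : ContDiffBump x₀, χ.rIn = r / 3 ∧ χ.rOut = r / 2 :=
    ⟨⟨r / 3, r / 2, by linarith, by linarith⟩, rfl, rfl⟩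
  have hs : tsupport (fun x => (χ x : ℂ)) ⊆ Metric.closedBall x₀ (r / 2) := by
    rw [← hout, ← χ.tsupport_eq]
    refine closure_mono fun x hx h => hx ?_
    simp [h]
  refine ⟨fun x => (χ x : ℂ), Complex.ofRealCLM.contDiff.comp χ.contDiff,
    (isCompact_closedBall _ _).of_isClosed_subset (isClosed_tsupport _) hs,
    Set.disjoint_left.2 fun x hx hx' => ?_, ?_, fun x hx => ?_⟩
  · have h1 := Metric.mem_closedBall.1 (hs hx)
    rw [Metric.mem_sphere.1 hx'] at h1
    linarith
  · simp only
    rw [χ.one_of_mem_closedBall (Metric.mem_closedBall_self χ.rIn_pos.le), Complex.ofReal_one]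
  · have h : (fun x => (χ x : ℂ)) =ᶠ[𝓝 x] fun _ => 1 := by
      filter_upwards [Metric.isOpen_ball.mem_nhds hx] with y hy
      rw [χ.one_of_mem_closedBall (hin ▸ Metric.ball_subset_closedBall hy), Complex.ofReal_one]
    ext i
    simp [cgrad, h.fderiv_eq]

/-- Complex plane wave Beltrami fields, cut off near the apex, as test fields: for a field with
`curl F = κ F + G` and vanishing tangential trace on the lateral boundary, `G` at the apex is
orthogonal to their limiting amplitude. -/
theorem bdot_waveAmp_eq_zero {x₀ a b : R3} (ha : ‖a‖ = 1) (hb : ‖b‖ = 1) (hab : inner ℝ a b = 0)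
    {θ₀ r₀ : ℝ} (hθ₀ : θ₀ ∈ Ioo 0 (Real.pi / 2)) (hr₀ : 0 < r₀) (κ : ℝ) {F C G : R3 → C3}
    (hF : IntegrableOn F (truncatedCone x₀ a θ₀ r₀))
    (hG : ContinuousOn G (closure (truncatedCone x₀ a θ₀ r₀)))
    (hC : ∀ᵐ x ∂(volume.restrict (truncatedCone x₀ a θ₀ r₀)), C x = (κ : ℂ) • F x + G x)
    (htr : ∀ φ : R3 → C3, ContDiff ℝ (⊤ : ℕ∞) φ → HasCompactSupport φ →
      Disjoint (tsupport φ) (Metric.sphere x₀ r₀) →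
      ∫ x in truncatedCone x₀ a θ₀ r₀, (bdot (C x) (φ x) - bdot (F x) (curl φ x)) = 0) :
    bdot (G x₀) (waveAmp a b 1 0) = 0 := by
  set Ω := truncatedCone x₀ a θ₀ r₀ with hΩ
  have hΩm : MeasurableSet Ω := (isOpen_truncatedCone ha hθ₀).measurableSet
  have hΩb : Bornology.IsBounded Ω := Metric.isBounded_ball.subset inter_subset_right
  obtain ⟨X, hX, hXc, hXd, hX0, hXg⟩ := exists_cutoff x₀ hr₀
  let l : ℝ → ℝ := fun s => κ / s
  let τ : ℝ → ℝ := fun s => √(1 + (l s) ^ 2)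
  have hl : Tendsto l atTop (𝓝 0) := tendsto_const_nhds.div_atTop tendsto_id
  have hτ : Tendsto τ atTop (𝓝 1) := by
    have h := (hl.pow 2).const_add 1
    simpa [τ] using h.sqrt
  let q : ℝ → C3 := fun s => waveAmp a b (τ s) (l s)
  have hq : Tendsto q atTop (𝓝 (waveAmp a b 1 0)) :=
    tendsto_waveAmp a b hτ hl
  let e : ℝ → R3 → ℂ := fun s x => Complex.exp (wavePhase a b s (τ s) (x - x₀))
  have hGj : ∀ j, ContinuousOn (fun x => X x * G x j) (closure Ω) := fun j =>
    hX.continuous.continuousOn.mul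
      ((EuclideanSpace.proj (𝕜 := ℂ) j).continuous.comp_continuousOn hG)
  have hFX := integrableOn_ccross_cgrad hΩm hΩb hF hX
  have hid : ∀ s : ℝ, 0 < s → ∑ j, q s j * ∫ x in Ω, X x * G x j * e s x =
      ∑ j, q s j * ∫ x in Ω, ccross (F x) (cgrad X x) j * e s x := by
    intro s hs
    have hτl : τ s ^ 2 = 1 + l s ^ 2 := Real.sq_sqrt (by positivity)
    have hsl : s * l s = κ := mul_div_cancel₀ _ hs.ne'
    exact sum_waveAmp_mul_integral_eq ha hb hab hΩm hΩb hF hG hC htr hX ⟨hXc, hXd⟩ hτl hsl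
  set I := ∫ y in {y : R3 | Real.cos θ₀ * ‖y‖ < inner ℝ a y}, Complex.exp (wavePhase a b 1 1 y)
  have hqj : ∀ j, Tendsto (fun s => q s j) atTop (𝓝 (waveAmp a b 1 0 j)) := fun j =>
    ((EuclideanSpace.proj (𝕜 := ℂ) j).continuous.tendsto _).comp hq
  have hA : Tendsto (fun s : ℝ => ∑ j, q s j * ((s : ℂ) ^ 3 * ∫ x in Ω, X x * G x j * e s x)) atTop
      (𝓝 (∑ j, waveAmp a b 1 0 j * (X x₀ * G x₀ j * I))) :=
    tendsto_finsetSum _ fun j _ => (hqj j).mul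
      (tendsto_pow_mul_setIntegral_cexp ha hθ₀ hr₀ hτ (hGj j))
  have hB : Tendsto (fun s : ℝ => ∑ j, q s j * ((s : ℂ) ^ 3 *
      ∫ x in Ω, ccross (F x) (cgrad X x) j * e s x)) atTop
      (𝓝 (∑ j, waveAmp a b 1 0 j * 0)) :=
    tendsto_finsetSum _ fun j _ => (hqj j).mul
      (tendsto_pow_mul_setIntegral_cexp_of_eq_zero ha hθ₀ τ (hFX j)
        (ρ := r₀ / 3) (by linarith) fun x hx => by
          rw [hXg x hx]
          fin_cases j <;> simp [ccross])
  have hAB := tendsto_nhds_unique (hA.congr' ?_) hB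
  · have hI0 : I ≠ 0 := integral_cexp_wavePhase_ne_zero ha hb hab hθ₀
    have h2 : bdot (G x₀) (waveAmp a b 1 0) * I = 0 := by
      simp only [mul_zero, Finset.sum_const_zero, hX0] at hAB
      rw [← hAB, bdot, Finset.sum_mul]
      exact Finset.sum_congr rfl fun j _ => by ring
    exact (mul_eq_zero.1 h2).resolve_right hI0
  · filter_upwards [eventually_gt_atTop 0] with s hs
    have h := congrArg (fun z => (s : ℂ) ^ 3 * z) (hid s hs)
    simp only [Finset.mul_sum] at h
    simpa only [mul_left_comm] using h

theorem eq_zero_of_forall_bdot_waveAmp {a : R3} (ha : ‖a‖ = 1) {z : C3}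
    (h : ∀ b : R3, ‖b‖ = 1 → inner ℝ a b = 0 → bdot z (waveAmp a b 1 0) = 0) : z = 0 := by
  let L : R3 →ₗ[ℝ] ℂ := ∑ i, (LinearMap.toSpanSingleton ℝ ℂ (z i)) ∘ₗ
    (EuclideanSpace.proj (𝕜 := ℝ) i : R3 →L[ℝ] ℝ).toLinearMap
  have hL : ∀ v, L v = ∑ i, z i * v i := fun v => by simp [L, mul_comm]
  have hw : ∀ b : R3, ‖b‖ = 1 → inner ℝ a b = 0 → L b + Complex.I * L a = 0 := by
    intro b hb hab
    rw [← h b hb hab, hL, hL]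
    simp [bdot, waveAmp, Fin.sum_univ_three]
    ring
  have hon : Orthonormal ℝ (({0} : Set (Fin 3)).domRestrict fun _ => a) := by
    rw [orthonormal_iff_ite]
    rintro ⟨i, rfl⟩ ⟨j, rfl⟩
    simp [ha]
  obtain ⟨B, hB⟩ := hon.exists_orthonormalBasis_extension_of_card_eq (by simp)
  have hB0 : B 0 = a := hB 0 rfl
  have hort : ∀ k, k ≠ 0 → inner ℝ a (B k) = 0 := fun k hk => by
    rw [← hB0]
    exact B.orthonormal.2 hk.symm
  have hLa : L a = 0 := by
    have h1 := hw (B 1) (B.norm_eq_one 1) (hort 1 (by decide))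
    have h2 := hw (-B 1) (by rw [norm_neg, B.norm_eq_one 1])
      (by rw [inner_neg_right, hort 1 (by decide), neg_zero])
    rw [map_neg] at h2
    have h3 : (2 * Complex.I) * L a = 0 := by linear_combination h1 + h2
    exact (mul_eq_zero.1 h3).resolve_left (by simp)
  have hL0 : L = 0 := by
    refine B.toBasis.ext fun k => ?_
    rw [B.coe_toBasis, LinearMap.zero_apply]
    rcases eq_or_ne k 0 with rfl | hk
    · rw [hB0, hLa]
    · simpa [hLa] using hw (B k) (B.norm_eq_one k) (hort k hk)
  ext i
  have h1 := hL (EuclideanSpace.single i 1)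
  rw [hL0] at h1
  simpa [apply_ite] using h1.symm

/-- For a coupled system `curl u = m v + J`, `curl v = n u + K`, a combination `α u + β v` that
diagonalizes the coupling has a source vanishing at the apex. -/
theorem source_eq_zero_at_apex {x₀ a : R3} (ha : ‖a‖ = 1)
    {θ₀ r₀ : ℝ} (hθ₀ : θ₀ ∈ Ioo 0 (Real.pi / 2)) (hr₀ : 0 < r₀) {u v J K : R3 → C3}
    (hu : MemHCurl (truncatedCone x₀ a θ₀ r₀) u) (hv : MemHCurl (truncatedCone x₀ a θ₀ r₀) v)
    (hJ : ContinuousOn J (closure (truncatedCone x₀ a θ₀ r₀)))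
    (hK : ContinuousOn K (closure (truncatedCone x₀ a θ₀ r₀)))
    {α β m n : ℂ} {κ : ℝ} (hm : α * m = κ * β) (hn : β * n = κ * α)
    (h₁ : ∀ᵐ x ∂(volume.restrict (truncatedCone x₀ a θ₀ r₀)),
      weakCurl (truncatedCone x₀ a θ₀ r₀) u x = m • v x + J x)
    (h₂ : ∀ᵐ x ∂(volume.restrict (truncatedCone x₀ a θ₀ r₀)),
      weakCurl (truncatedCone x₀ a θ₀ r₀) v x = n • u x + K x)
    (htu : TangentialTraceVanishesOn (truncatedCone x₀ a θ₀ r₀) (lateralBoundary x₀ a θ₀ r₀) u)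
    (htv : TangentialTraceVanishesOn (truncatedCone x₀ a θ₀ r₀) (lateralBoundary x₀ a θ₀ r₀) v) :
    α • J x₀ + β • K x₀ = 0 := by
  set Ω := truncatedCone x₀ a θ₀ r₀ with hΩ
  have hΩm : MeasurableSet Ω := (isOpen_truncatedCone ha hθ₀).measurableSet
  have hΩb : Bornology.IsBounded Ω := Metric.isBounded_ball.subset inter_subset_right
  have : IsFiniteMeasure (volume.restrict Ω) := ⟨by simpa using hΩb.measure_lt_top⟩
  have hint : ∀ {w : R3 → C3}, MemHCurl Ω w → IntegrableOn w Ω ∧ IntegrableOn (weakCurl Ω w) Ω := by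
    intro w hw
    have h : IsWeakCurl Ω w (weakCurl Ω w) := by
      rw [weakCurl, dif_pos hw]
      exact hw.choose_spec
    exact ⟨h.1.integrable (by norm_num), h.2.1.integrable (by norm_num)⟩
  refine eq_zero_of_forall_bdot_waveAmp ha fun b hb hab =>
    bdot_waveAmp_eq_zero ha hb hab hθ₀ hr₀ κ (F := fun x => α • u x + β • v x)
      (C := fun x => α • weakCurl Ω u x + β • weakCurl Ω v x) (G := fun x => α • J x + β • K x)
      (((hint hu).1.smul α).add ((hint hv).1.smul β))
      ((hJ.const_smul α).add (hK.const_smul β)) ?_ ?_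
  · filter_upwards [h₁, h₂] with x hx hy
    rw [hx, hy, smul_add, smul_add, smul_add, smul_smul, smul_smul, smul_smul, smul_smul, hm, hn]
    abel
  · intro φ hφ hφc hφs
    have hd : Disjoint (tsupport φ) (frontier Ω \ lateralBoundary x₀ a θ₀ r₀) := by
      refine hφs.mono_right fun x hx => ?_
      by_contra hxs
      exact hx.2 ⟨hx.1, hxs⟩
    have hi : ∀ {w : R3 → C3}, MemHCurl Ω w →
        IntegrableOn (fun x => bdot (weakCurl Ω w x) (φ x) - bdot (w x) (curl φ x)) Ω := fun hw =>
      (integrableOn_bdot hΩm hΩb (hint hw).2 hφ.continuous).sub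
        (integrableOn_bdot hΩm hΩb (hint hw).1 (continuous_curl hφ))
    have e1 := htu φ hφ hφc hd
    have e2 := htv φ hφ hφc hd
    rw [tangentialTrace] at e1 e2
    calc _ = ∫ x in Ω, (α * (bdot (weakCurl Ω u x) (φ x) - bdot (u x) (curl φ x)) +
          β * (bdot (weakCurl Ω v x) (φ x) - bdot (v x) (curl φ x))) := by
          congr 1
          funext x
          simp [bdot, Fin.sum_univ_three]
          ring
      _ = 0 := by
          rw [integral_add ((hi hu).const_mul α) ((hi hv).const_mul β), integral_const_mul,
            integral_const_mul, e1, e2, mul_zero, mul_zero, add_zero]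

theorem theorem2p1 (x₀ a : R3) (ha : ‖a‖ = 1) (θ₀ r₀ : ℝ)
    (hθ₀ : θ₀ ∈ Set.Ioo 0 (Real.pi / 2)) (hr₀ : 0 < r₀)
    (ω ε₀ μ₀ : ℝ) (hω : 0 < ω) (hε₀ : 0 < ε₀) (hμ₀ : 0 < μ₀)
    (α : ℝ≥0) (hα₀ : 0 < α) (hα₁ : α < 1) (J₁ J₂ E H : R3 → C3)
    (hJ₁ : ∃ C : ℝ≥0, HolderOnWith C α J₁ (closure (truncatedCone x₀ a θ₀ r₀)))
    (hJ₂ : ∃ C : ℝ≥0, HolderOnWith C α J₂ (closure (truncatedCone x₀ a θ₀ r₀)))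
    (hE : MemHCurl (truncatedCone x₀ a θ₀ r₀) E)
    (hH : MemHCurl (truncatedCone x₀ a θ₀ r₀) H)
    (hMaxwell₁ : ∀ᵐ x ∂(volume.restrict (truncatedCone x₀ a θ₀ r₀)),
      weakCurl (truncatedCone x₀ a θ₀ r₀) E x - (Complex.I * ω * μ₀) • H x = J₁ x)
    (hMaxwell₂ : ∀ᵐ x ∂(volume.restrict (truncatedCone x₀ a θ₀ r₀)),
      weakCurl (truncatedCone x₀ a θ₀ r₀) H x + (Complex.I * ω * ε₀) • E x = J₂ x)
    (htraceE : TangentialTraceVanishesOn (truncatedCone x₀ a θ₀ r₀)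
      (lateralBoundary x₀ a θ₀ r₀) E)
    (htraceH : TangentialTraceVanishesOn (truncatedCone x₀ a θ₀ r₀)
      (lateralBoundary x₀ a θ₀ r₀) H) :
    J₁ x₀ = 0 ∧ J₂ x₀ = 0 := by
  obtain ⟨C₁, hC₁⟩ := hJ₁
  obtain ⟨C₂, hC₂⟩ := hJ₂
  have hε : ((√ε₀ : ℝ) : ℂ) ^ 2 = ε₀ := by exact_mod_cast Real.sq_sqrt hε₀.le
  have hμ : ((√μ₀ : ℝ) : ℂ) ^ 2 = μ₀ := by exact_mod_cast Real.sq_sqrt hμ₀.le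
  have key : ∀ σ : ℝ, σ ^ 2 = 1 →
      ((√ε₀ : ℝ) : ℂ) • J₁ x₀ + (Complex.I * σ * (√μ₀ : ℝ)) • J₂ x₀ = 0 := by
    intro σ hσ
    have hσ' : (σ : ℂ) ^ 2 = 1 := by exact_mod_cast hσ
    refine source_eq_zero_at_apex ha hθ₀ hr₀ hE hH (hC₁.continuousOn hα₀) (hC₂.continuousOn hα₀)
      (m := Complex.I * ω * μ₀) (n := -(Complex.I * ω * ε₀)) (κ := σ * ω * √ε₀ * √μ₀)
      ?_ ?_ ?_ ?_ htraceE htraceH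
    · rw [← hμ]
      push_cast
      linear_combination (-(√ε₀ : ℝ) * Complex.I * ω * (√μ₀ : ℝ) ^ 2 : ℂ) * hσ'
    · rw [← hε]
      push_cast
      linear_combination (-(σ : ℂ) * (√μ₀ : ℝ) * ω * (√ε₀ : ℝ) ^ 2 : ℂ) * Complex.I_sq
    · filter_upwards [hMaxwell₁] with x hx
      rw [← hx]
      abel
    · filter_upwards [hMaxwell₂] with x hx
      rw [← hx, neg_smul]
      abel
  have hp := key 1 (by norm_num)
  have hm := key (-1) (by norm_num)
  have hεne : ((√ε₀ : ℝ) : ℂ) ≠ 0 := by exact_mod_cast (Real.sqrt_pos.2 hε₀).ne'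
  have hμne : ((√μ₀ : ℝ) : ℂ) ≠ 0 := by exact_mod_cast (Real.sqrt_pos.2 hμ₀).ne'
  constructor
  · ext i
    have h1 := congrArg (fun z : C3 => z i) hp
    have h2 := congrArg (fun z : C3 => z i) hm
    simp at h1 h2 ⊢
    have h3 : (2 * ((√ε₀ : ℝ) : ℂ)) * J₁ x₀ i = 0 := by linear_combination h1 + h2
    exact (mul_eq_zero.1 h3).resolve_left (mul_ne_zero two_ne_zero hεne)
  · ext i
    have h1 := congrArg (fun z : C3 => z i) hp
    have h2 := congrArg (fun z : C3 => z i) hm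
    simp at h1 h2 ⊢
    have h3 : (2 * (Complex.I * ((√μ₀ : ℝ) : ℂ))) * J₂ x₀ i = 0 := by linear_combination h1 - h2
    exact (mul_eq_zero.1 h3).resolve_left
      (mul_ne_zero two_ne_zero (mul_ne_zero Complex.I_ne_zero hμne))
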